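/- Let $\mathbb D=\{u\in\mathbb R^2:\|u\|<1\}$ be the Poincar\'e disk, with hyperbolic distance $\operatorname{dist}_{\mathbb H}(u,v)=2\operatorname{arcsinh}\Big(\frac{\|u-v\|}{\sqrt{(1-\|u\|^2)(1-\|v\|^2)}}\Big)$ and hyperbolic area $\operatorname{area}_{\mathbb H}(A)=\int_A\frac{4}{(1-\|u\|^2)^2}\,du$ for measurable $A\subseteq\mathbb D$. Let $\lambda>0$ and let $\mathcal Z\subseteq\mathbb D$ be a Poisson point process of constant intensity $\lambda$ with respect to $\operatorname{area}_{\mathbb H}$: for every measurable $A\subseteq\mathbb D$ the number $|\mathcal Z\cap A|$ is Poisson distributed with mean $\lambda\operatorname{area}_{\mathbb H}(A)$ (almost surely infinite if the mean is infinite), and for disjoint measurable $A_1,\dots,A_m\subseteq\mathbb D$ the numbers $|\mathcal Z\cap A_1|,\dots,|\mathcal Z\cap A_m|$ are independent. For $z\in\mathcal Z$ define the Euclidean and hyperbolic Voronoi cells $$C_{\mathbb R}(z)=\{u\in\mathbb R^2:\|u-z\|=\inf_{z'\in\mathcal Z}\|u-z'\|\},\qquad C_{\mathbb H}(z)=\{u\in\mathbb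 D:\operatorname{dist}_{\mathbb H}(u,z)=\inf_{z'\in\mathcal Z}\operatorname{dist}_{\mathbb H}(u,z')\},$$ and say that two cells touch if they have a point in common. Then, almost surely, for all $z_1,z_2\in\mathcal Z$, the cells $C_{\mathbb R}(z_1)$ and $C_{\mathbb R}(z_2)$ touch if and only if the cells $C_{\mathbb H}(z_1)$ and $C_{\mathbb H}(z_2)$ touch. -/

import Mathlib

open MeasureTheory ProbabilityTheory
open scoped ENNReal NNReal

noncomputable section

namespace HypVoronoi

/-- The Euclidean plane. -/
abbrev Plane : Type := EuclideanSpace ℝ (Fin 2)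

/-- The open unit disk, the underlying set of the Poincaré disk model. -/
def Dee : Set Plane := Metric.ball 0 1

/-- The hyperbolic distance of the Poincaré disk model, for points `u`, `v` of the unit disk. -/
def distH (u v : Plane) : ℝ :=
  2 * Real.arsinh (‖u - v‖ / √((1 - ‖u‖ ^ 2) * (1 - ‖v‖ ^ 2)))

/-- The hyperbolic area of a measurable subset `A` of the unit disk. -/
def areaH (A : Set Plane) : ℝ≥0∞ :=
  ∫⁻ u in A, ENNReal.ofReal (4 / (1 - ‖u‖ ^ 2) ^ 2)

/-- The hyperbolic Voronoi cell of `z` with respect to the point set `Z`. -/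
def cellH (Z : Set Plane) (z : Plane) : Set Plane :=
  {u | u ∈ Dee ∧ distH u z = ⨅ z' : Z, distH u z'}

/-- The Euclidean Voronoi cell of `z` with respect to the point set `Z`, as a subset of the
whole plane. -/
def cellR (Z : Set Plane) (z : Plane) : Set Plane :=
  {u | ‖u - z‖ = ⨅ z' : Z, ‖u - (z' : Plane)‖}

/-- Two cells touch if they have a point in common. -/
def Touch (C D : Set Plane) : Prop := (C ∩ D).Nonempty

/-- The Poisson distribution with mean `r ∈ [0, ∞]`, as a measure on `ℕ∞`. A Poisson variable
with infinite mean is almost surely infinite. -/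
def poissonLaw (r : ℝ≥0∞) : Measure ℕ∞ :=
  if r = ∞ then Measure.dirac ⊤ else (poissonMeasure r.toNNReal).map ((↑) : ℕ → ℕ∞)

/-- The number of points of `Z` in `A`. -/
def count (Z A : Set Plane) : ℕ∞ := (Z ∩ A).encard

/-- `Z` is a homogeneous Poisson point process of intensity `lam` on the hyperbolic plane,
in the Poincaré disk model, defined on the probability space `(Ω, P)`. -/
structure IsHyperbolicPPP {Ω : Type*} [MeasurableSpace Ω] (P : Measure Ω) (lam : ℝ)
    (Z : Ω → Set Plane) : Prop where
  /-- The points lie in the unit disk. -/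
  subset_disk : ∀ ω, Z ω ⊆ Dee
  /-- The number of points in a measurable set is a random variable. -/
  measurable_count : ∀ A : Set Plane, MeasurableSet A → A ⊆ Dee →
    Measurable fun ω => count (Z ω) A
  /-- The number of points in `A` is Poisson distributed with mean `lam * areaH A`. -/
  law_count : ∀ A : Set Plane, MeasurableSet A → A ⊆ Dee →
    P.map (fun ω => count (Z ω) A) = poissonLaw (ENNReal.ofReal lam * areaH A)
  /-- The numbers of points in finitely many disjoint sets are independent. -/
  indep_count : ∀ (m : ℕ) (A : Fin m → Set Plane), (∀ i, MeasurableSet (A i)) →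
    (∀ i, A i ⊆ Dee) → (∀ i j, i ≠ j → Disjoint (A i) (A j)) →
    iIndepFun (fun i ω => count (Z ω) (A i)) P

end HypVoronoi

end

open MeasureTheory ProbabilityTheory Filter Topology
open scoped ENNReal NNReal

namespace HypVoronoi

/-! ### Cells and touching -/

/-! Two cells touch exactly when some circle passes through both points and has no point of `Z`
inside. Hyperbolic circles are the Euclidean circles that lie with their interior in the unit disk,
only with another centre (`norm_smul_sub_sq`, `exists_hyperbolic_center`). Hence hyperbolic touching
always implies Euclidean touching, and the converse can fail only through an empty disk that is not
compactly contained in the unit disk.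

Such a disk contains a horodisk (`exists_horodisk_subset`), so it suffices that almost surely no
horodisk is empty (`ae_forall_horodisk_nonempty`). A horodisk shrunk by `ε` still has area of order
at least `ε ^ (-1/2)`, while order `1 / ε` directions suffice to approximate all of them; a union
bound then gives probability zero. -/

theorem eq_iInf_iff {α : Type*} {Z : Set α} {f : α → ℝ} (hf : ∀ x, 0 ≤ f x) {z : α} (hz : z ∈ Z) :
    f z = ⨅ z' : Z, f z' ↔ ∀ z' ∈ Z, f z ≤ f z' := by
  have hb : BddBelow (Set.range fun z' : Z => f z') := ⟨0, by rintro _ ⟨x, rfl⟩; exact hf x⟩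
  have : Nonempty Z := ⟨⟨z, hz⟩⟩
  constructor
  · intro h z' hz'
    rw [h]
    exact ciInf_le hb ⟨z', hz'⟩
  · intro h
    exact le_antisymm (le_ciInf fun z' => h z' z'.2) (ciInf_le hb ⟨z, hz⟩)

theorem distH_nonneg (u v : Plane) : 0 ≤ distH u v :=
  mul_nonneg zero_le_two (Real.arsinh_nonneg_iff.2 (by positivity))

theorem mem_Dee {u : Plane} : u ∈ Dee ↔ ‖u‖ < 1 := mem_ball_zero_iff

theorem one_sub_norm_sq_pos {u : Plane} (hu : u ∈ Dee) : 0 < 1 - ‖u‖ ^ 2 := by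
  have := mem_Dee.1 hu
  nlinarith [norm_nonneg u]

theorem distH_le_distH_iff {u v w : Plane} (hu : u ∈ Dee) (hv : v ∈ Dee) (hw : w ∈ Dee) :
    distH u v ≤ distH u w ↔
      ‖u - v‖ ^ 2 * (1 - ‖w‖ ^ 2) ≤ ‖u - w‖ ^ 2 * (1 - ‖v‖ ^ 2) := by
  have hu' := one_sub_norm_sq_pos hu
  have hv' := one_sub_norm_sq_pos hv
  have hw' := one_sub_norm_sq_pos hw
  unfold distH
  rw [mul_le_mul_iff_right₀ zero_lt_two, Real.arsinh_le_arsinh,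
    ← sq_le_sq₀ (by positivity) (by positivity), div_pow, div_pow,
    Real.sq_sqrt (by positivity), Real.sq_sqrt (by positivity),
    div_le_div_iff₀ (by positivity) (by positivity)]
  rw [show ‖u - v‖ ^ 2 * ((1 - ‖u‖ ^ 2) * (1 - ‖w‖ ^ 2)) =
      (1 - ‖u‖ ^ 2) * (‖u - v‖ ^ 2 * (1 - ‖w‖ ^ 2)) by ring,
    show ‖u - w‖ ^ 2 * ((1 - ‖u‖ ^ 2) * (1 - ‖v‖ ^ 2)) =
      (1 - ‖u‖ ^ 2) * (‖u - w‖ ^ 2 * (1 - ‖v‖ ^ 2)) by ring,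
    mul_le_mul_iff_right₀ hu']

theorem mem_cellR_iff {Z : Set Plane} {z u : Plane} (hz : z ∈ Z) :
    u ∈ cellR Z z ↔ ∀ z' ∈ Z, ‖u - z‖ ≤ ‖u - z'‖ :=
  eq_iInf_iff (f := fun z => ‖u - z‖) (fun _ => norm_nonneg _) hz

theorem mem_cellH_iff {Z : Set Plane} (hZ : Z ⊆ Dee) {z u : Plane} (hz : z ∈ Z) :
    u ∈ cellH Z z ↔ u ∈ Dee ∧ ∀ z' ∈ Z,
      ‖u - z‖ ^ 2 * (1 - ‖z'‖ ^ 2) ≤ ‖u - z'‖ ^ 2 * (1 - ‖z‖ ^ 2) := by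
  unfold cellH
  rw [Set.mem_ofPred_eq, eq_iInf_iff (f := fun z => distH u z) (fun _ => distH_nonneg _ _) hz]
  refine and_congr_right fun hu => forall₂_congr fun z' hz' => ?_
  exact distH_le_distH_iff hu (hZ hz) (hZ hz')

/-- The defining function of a hyperbolic circle with hyperbolic centre `t • c` is a multiple of
the defining function of a Euclidean circle with centre `c`. -/
theorem norm_smul_sub_sq (c z : Plane) (t : ℝ) :
    ‖t • c - z‖ ^ 2 - (t - 1) * (1 - ‖z‖ ^ 2) =
      t * ‖c - z‖ ^ 2 + (t ^ 2 * ‖c‖ ^ 2 - t * ‖c‖ ^ 2 - t + 1) := by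
  rw [norm_sub_sq_real, norm_sub_sq_real, norm_smul, inner_smul_left, mul_pow, Real.norm_eq_abs,
    sq_abs]
  simp only [conj_trivial]
  ring

theorem Touch.cellR_of_cellH {Z : Set Plane} (hZ : Z ⊆ Dee) {z₁ z₂ : Plane} (h₁ : z₁ ∈ Z)
    (h₂ : z₂ ∈ Z) (h : Touch (cellH Z z₁) (cellH Z z₂)) :
    Touch (cellR Z z₁) (cellR Z z₂) := by
  obtain ⟨u, hu₁, hu₂⟩ := h
  rw [mem_cellH_iff hZ h₁] at hu₁
  rw [mem_cellH_iff hZ h₂] at hu₂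
  have p₁ := one_sub_norm_sq_pos (hZ h₁)
  -- `‖u - z‖ ^ 2 = Q * (1 - ‖z‖ ^ 2)` is the hyperbolic circle around `u` through `z₁`. Its
  -- Euclidean centre is `u / (1 + Q)`.
  set Q : ℝ := ‖u - z₁‖ ^ 2 / (1 - ‖z₁‖ ^ 2) with hQ
  have hQ0 : 0 ≤ Q := by positivity
  have e₁ : ‖u - z₁‖ ^ 2 = Q * (1 - ‖z₁‖ ^ 2) := by rw [hQ]; field_simp
  have hle : ∀ z ∈ Z, Q * (1 - ‖z‖ ^ 2) ≤ ‖u - z‖ ^ 2 := by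
    intro z hz
    have := hu₁.2 z hz
    rw [e₁] at this
    refine le_of_mul_le_mul_right ?_ p₁
    linarith
  have e₂ : ‖u - z₂‖ ^ 2 = Q * (1 - ‖z₂‖ ^ 2) := by
    refine le_antisymm ?_ (hle z₂ h₂)
    have := hu₂.2 z₁ h₁
    rw [e₁] at this
    refine le_of_mul_le_mul_right ?_ p₁
    linarith
  set t : ℝ := 1 + Q with ht
  have ht0 : 0 < t := by positivity
  have hu : u = t • (t⁻¹ • u) := by rw [smul_smul, mul_inv_cancel₀ ht0.ne', one_smul]
  set c : Plane := t⁻¹ • u with hc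
  have key : ∀ z, ‖u - z‖ ^ 2 - Q * (1 - ‖z‖ ^ 2) =
      t * ‖c - z‖ ^ 2 + (t ^ 2 * ‖c‖ ^ 2 - t * ‖c‖ ^ 2 - t + 1) := by
    intro z
    rw [← norm_smul_sub_sq c z t, ← hu, ht, add_sub_cancel_left]
  have fin : ∀ w, ‖u - w‖ ^ 2 = Q * (1 - ‖w‖ ^ 2) → ∀ z ∈ Z, ‖c - w‖ ≤ ‖c - z‖ := by
    intro w hw z hz
    rw [← sq_le_sq₀ (norm_nonneg _) (norm_nonneg _)]
    refine le_of_mul_le_mul_left ?_ ht0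
    have a := key w
    have b := key z
    have d := hle z hz
    linarith
  exact ⟨c, (mem_cellR_iff h₁).2 (fin z₁ e₁), (mem_cellR_iff h₂).2 (fin z₂ e₂)⟩

/-- A Euclidean disk that lies in the unit disk with its boundary is a hyperbolic disk. -/
theorem exists_hyperbolic_center {a r : ℝ} (ha : 0 ≤ a) (hr : 0 ≤ r) (har : a + r < 1) :
    ∃ t : ℝ, 0 < t ∧ t * a < 1 ∧ t ^ 2 * a ^ 2 - t * a ^ 2 - t + 1 = -(t * r ^ 2) := by
  set b : ℝ := 1 + a ^ 2 - r ^ 2 with hb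
  have hb2 : 2 * a < b := by nlinarith
  have hD : 0 ≤ b ^ 2 - 4 * a ^ 2 := by nlinarith
  set D : ℝ := √(b ^ 2 - 4 * a ^ 2) with hDdef
  have hD0 : 0 ≤ D := Real.sqrt_nonneg _
  have hDs : D ^ 2 = b ^ 2 - 4 * a ^ 2 := Real.sq_sqrt hD
  have hpos : 0 < b + D := by linarith
  -- The smaller root of `a ^ 2 * t ^ 2 - b * t + 1 = 0`, in a form that also covers `a = 0`.
  refine ⟨2 / (b + D), by positivity, ?_, ?_⟩
  · rw [div_mul_eq_mul_div, div_lt_one hpos]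
    linarith
  · have hr2 : r ^ 2 = 1 + a ^ 2 - b := by rw [hb]; ring
    rw [hr2]
    field_simp
    nlinarith

theorem Touch.cellH_of_cellR {Z : Set Plane} (hZ : Z ⊆ Dee) {z₁ z₂ : Plane} (h₁ : z₁ ∈ Z)
    (h₂ : z₂ ∈ Z) {c : Plane} (hc₁ : c ∈ cellR Z z₁) (hc₂ : c ∈ cellR Z z₂)
    (hc : ‖c‖ + ‖c - z₁‖ < 1) :
    Touch (cellH Z z₁) (cellH Z z₂) := by
  rw [mem_cellR_iff h₁] at hc₁
  rw [mem_cellR_iff h₂] at hc₂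
  obtain ⟨t, ht, hta, hroot⟩ := exists_hyperbolic_center (norm_nonneg c) (norm_nonneg _) hc
  have key : ∀ z, ‖t • c - z‖ ^ 2 =
      (t - 1) * (1 - ‖z‖ ^ 2) + t * (‖c - z‖ ^ 2 - ‖c - z₁‖ ^ 2) := by
    intro z
    linarith [norm_smul_sub_sq c z t]
  have hu : t • c ∈ Dee := by
    rw [mem_Dee, norm_smul, Real.norm_of_nonneg ht.le]
    exact hta
  have h12 : ‖c - z₂‖ = ‖c - z₁‖ := le_antisymm (hc₂ z₁ h₁) (hc₁ z₂ h₂)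
  have fin : ∀ w ∈ Z, ‖c - w‖ = ‖c - z₁‖ → t • c ∈ cellH Z w := by
    intro w hw hwe
    refine (mem_cellH_iff hZ hw).2 ⟨hu, fun z hz => ?_⟩
    rw [key w, key z, hwe, sub_self, mul_zero, add_zero]
    have hp := one_sub_norm_sq_pos (hZ hw)
    have : 0 ≤ ‖c - z‖ ^ 2 - ‖c - z₁‖ ^ 2 :=
      sub_nonneg.2 (pow_le_pow_left₀ (norm_nonneg _) (hc₁ z hz) 2)
    nlinarith [mul_nonneg (mul_nonneg ht.le this) hp.le]
  exact ⟨t • c, fin z₁ h₁ rfl, fin z₂ h₂ h12⟩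

/-! ### Horodisks -/

/-- A disk whose boundary meets the unit disk and that is not contained in it with its boundary
contains a horodisk. -/
theorem exists_horodisk_subset {c z : Plane} (hz : z ∈ Dee) (h : 1 ≤ ‖c‖ + ‖c - z‖) :
    ∃ s : ℝ, 0 < s ∧ ∃ ξ : Plane, ‖ξ‖ = 1 ∧
      ∀ s', 0 < s' → s' ≤ s → Metric.ball ((1 - s') • ξ) s' ⊆ Metric.ball c ‖c - z‖ := by
  rw [mem_Dee] at hz
  have hc : c ≠ 0 := by
    rintro rfl
    simp only [norm_zero, zero_sub, norm_neg, zero_add] at h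
    linarith
  have hc0 : 0 < ‖c‖ := norm_pos_iff.2 hc
  have hle : ‖c‖ ≤ ‖c - z‖ + ‖z‖ := by simpa using norm_add_le (c - z) z
  set r := ‖c - z‖
  have hξ : ‖‖c‖⁻¹ • c‖ = 1 := by
    rw [norm_smul, norm_inv, norm_norm, inv_mul_cancel₀ hc0.ne']
  have hdist : ∀ s, dist ((1 - s) • (‖c‖⁻¹ • c)) c = |1 - s - ‖c‖| := by
    intro s
    have : (1 - s) • (‖c‖⁻¹ • c) - c = (1 - s - ‖c‖) • (‖c‖⁻¹ • c) := by
      rw [sub_smul (1 - s) ‖c‖, smul_smul ‖c‖, mul_inv_cancel₀ hc0.ne', one_smul]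
    rw [dist_eq_norm, this, norm_smul, hξ, mul_one, Real.norm_eq_abs]
  -- The horodisk is tangent to the unit circle at `ξ = c / ‖c‖`. Its point farthest from `c` is `ξ`
  -- in the first case and `(1 - 2 * s) • ξ` in the second, where `‖c‖ < r + 1` makes the radius
  -- positive.
  rcases lt_or_ge ‖c‖ 1 with h1 | h1
  · refine ⟨1 - ‖c‖, by linarith, ‖c‖⁻¹ • c, hξ, fun s _ hs => Metric.ball_subset_ball' ?_⟩
    rw [hdist, abs_of_nonneg (by linarith)]
    linarith
  · refine ⟨(r - ‖c‖ + 1) / 2, by linarith, ‖c‖⁻¹ • c, hξ, fun s _ hs =>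
      Metric.ball_subset_ball' ?_⟩
    rw [hdist, abs_of_nonpos (by linarith)]
    linarith

/-! ### Hyperbolic area of large disks -/

theorem volume_orthonormal_rectangle (b : OrthonormalBasis (Fin 2) ℝ Plane) (l₀ r₀ l₁ r₁ : ℝ) :
    volume {u : Plane | b.repr u 0 ∈ Set.Icc l₀ r₀ ∧ b.repr u 1 ∈ Set.Icc l₁ r₁} =
      ENNReal.ofReal (r₀ - l₀) * ENNReal.ofReal (r₁ - l₁) := by
  have hm := (PiLp.volume_preserving_ofLp (Fin 2)).comp b.measurePreserving_repr
  have hset : {u : Plane | b.repr u 0 ∈ Set.Icc l₀ r₀ ∧ b.repr u 1 ∈ Set.Icc l₁ r₁} =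
      (WithLp.ofLp ∘ b.repr) ⁻¹' (Set.univ.pi ![Set.Icc l₀ r₀, Set.Icc l₁ r₁]) := by
    ext u
    simp [Set.mem_pi, Fin.forall_fin_two]
  rw [hset, hm.measure_preimage, volume_pi_pi]
  · simp [Fin.prod_univ_two]
  · refine (MeasurableSet.univ_pi fun i => ?_).nullMeasurableSet
    fin_cases i <;> exact measurableSet_Icc

theorem exists_orthonormalBasis_zero_eq {ξ : Plane} (hξ : ‖ξ‖ = 1) :
    ∃ b : OrthonormalBasis (Fin 2) ℝ Plane, b 0 = ξ := by
  have h : Orthonormal ℝ (({0} : Set (Fin 2)).domRestrict fun _ => ξ) := by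
    refine ⟨fun _ => hξ, fun i j hij => (hij (Subsingleton.elim i j)).elim⟩
  obtain ⟨b, hb⟩ := h.exists_orthonormalBasis_extension_of_card_eq (by simp)
  exact ⟨b, hb 0 rfl⟩

theorem ball_subset_Dee {ξ : Plane} (hξ : ‖ξ‖ = 1) {s ε : ℝ} (hs : s ≤ 1) (hε : 0 ≤ ε) :
    Metric.ball ((1 - s) • ξ) (s - ε) ⊆ Dee := by
  refine Metric.ball_subset_ball' ?_
  rw [dist_zero_right, norm_smul, hξ, Real.norm_of_nonneg (by linarith)]
  linarith

/-- The shrunken horodisk contains an `ε` by `√(ε * s)` rectangle near `ξ`, on which the density is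
at least `4 / (6 * ε) ^ 2`. -/
theorem le_areaH_ball {ξ : Plane} (hξ : ‖ξ‖ = 1) {s ε : ℝ} (hs : s ≤ 1) (hε : 0 < ε)
    (hεs : 4 * ε ≤ s) :
    ENNReal.ofReal (√s / (9 * √ε)) ≤ areaH (Metric.ball ((1 - s) • ξ) (s - ε)) := by
  obtain ⟨b, hb⟩ := exists_orthonormalBasis_zero_eq hξ
  have hs0 : 0 < s := by linarith
  set w : ℝ := √(ε * s) / 2 with hw
  have hw0 : 0 ≤ w := by positivity
  have hw2 : w ^ 2 = ε * s / 4 := by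
    rw [hw, div_pow, Real.sq_sqrt (by positivity)]; norm_num
  set S : Set Plane := {u | b.repr u 0 ∈ Set.Icc (1 - 3 * ε) (1 - 2 * ε) ∧
    b.repr u 1 ∈ Set.Icc (-w) w} with hS
  have hnorm : ∀ u : Plane, ‖u‖ ^ 2 = (b.repr u 0) ^ 2 + (b.repr u 1) ^ 2 := by
    intro u
    rw [← b.repr.norm_map u, EuclideanSpace.norm_sq_eq, Fin.sum_univ_two, Real.norm_eq_abs,
      Real.norm_eq_abs, sq_abs, sq_abs]
  have hr : ∀ u : Plane, b.repr (u - (1 - s) • ξ) 0 = b.repr u 0 - (1 - s) ∧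
      b.repr (u - (1 - s) • ξ) 1 = b.repr u 1 := by
    intro u
    rw [← hb]
    simp
  have hSsub : S ⊆ Metric.ball ((1 - s) • ξ) (s - ε) := by
    rintro u ⟨⟨h1, h2⟩, h3, h4⟩
    rw [mem_ball_iff_norm, ← sq_lt_sq₀ (norm_nonneg _) (by linarith), hnorm, (hr u).1, (hr u).2]
    have : b.repr u 1 ^ 2 ≤ w ^ 2 := sq_le_sq' h3 h4
    -- Amounts to `(s - 2 * ε) ^ 2 + ε * s / 4 < (s - ε) ^ 2`, which holds since `4 * ε ≤ s`.
    nlinarith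
  have hSm : MeasurableSet S := by
    have : IsClosed S := by
      refine IsClosed.inter ?_ ?_
      · exact isClosed_Icc.preimage (by fun_prop)
      · exact isClosed_Icc.preimage (by fun_prop)
    exact this.measurableSet
  have hdens : ∀ u ∈ S, ENNReal.ofReal (1 / (9 * ε ^ 2)) ≤
      ENNReal.ofReal (4 / (1 - ‖u‖ ^ 2) ^ 2) := by
    intro u hu
    have hp := one_sub_norm_sq_pos (ball_subset_Dee hξ hs hε.le (hSsub hu))
    obtain ⟨⟨h1, h2⟩, -⟩ := hu
    refine ENNReal.ofReal_le_ofReal ?_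
    have : 1 - ‖u‖ ^ 2 ≤ 6 * ε := by
      rw [hnorm]
      nlinarith [sq_nonneg (b.repr u 1)]
    rw [div_le_div_iff₀ (by positivity) (by positivity)]
    nlinarith
  calc ENNReal.ofReal (√s / (9 * √ε))
      = ENNReal.ofReal (1 / (9 * ε ^ 2)) * volume S := by
        rw [hS, volume_orthonormal_rectangle, ← ENNReal.ofReal_mul (by linarith),
          ← ENNReal.ofReal_mul (by positivity)]
        congr 1
        have e : √ε * √ε = ε := Real.mul_self_sqrt hε.le
        have : √ε ≠ 0 := by positivity
        rw [hw, Real.sqrt_mul hε.le]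
        field_simp
        rw [Real.sq_sqrt hε.le]
        ring
    _ = ∫⁻ _ in S, ENNReal.ofReal (1 / (9 * ε ^ 2)) := by
        rw [setLIntegral_const]
    _ ≤ ∫⁻ u in S, ENNReal.ofReal (4 / (1 - ‖u‖ ^ 2) ^ 2) := setLIntegral_mono' hSm hdens
    _ ≤ areaH (Metric.ball ((1 - s) • ξ) (s - ε)) := lintegral_mono_set hSsub

/-! ### Every horodisk contains a point -/

theorem poissonLaw_zero_le {r : ℝ≥0∞} {x : ℝ} (h : ENNReal.ofReal x ≤ r) :
    poissonLaw r {0} ≤ ENNReal.ofReal (Real.exp (-x)) := by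
  unfold poissonLaw
  split_ifs with hr
  · simp
  · rw [Measure.map_apply (measurable_of_countable _) (measurableSet_singleton _)]
    have : ((↑) : ℕ → ℕ∞) ⁻¹' {0} = {0} := by ext; simp
    rw [this]
    have hx : x ≤ r.toReal := (ENNReal.ofReal_le_iff_le_toReal hr).1 h
    rw [poissonMeasure_singleton]
    refine ENNReal.ofReal_le_ofReal ?_
    simpa [ENNReal.coe_toNNReal_eq_toReal] using hx

theorem IsHyperbolicPPP.measure_inter_eq_empty_le {Ω : Type*} [MeasurableSpace Ω] {P : Measure Ω}
    {lam : ℝ} {Z : Ω → Set Plane} (hZ : IsHyperbolicPPP P lam Z) (hlam : 0 ≤ lam) {A : Set Plane}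
    (hA : MeasurableSet A) (hAD : A ⊆ Dee) {x : ℝ} (hx : ENNReal.ofReal x ≤ areaH A) :
    P {ω | Z ω ∩ A = ∅} ≤ ENNReal.ofReal (Real.exp (-(lam * x))) := by
  have h : {ω | Z ω ∩ A = ∅} = (fun ω => count (Z ω) A) ⁻¹' {0} := by
    ext ω
    simp [count]
  rw [h, ← Measure.map_apply (hZ.measurable_count A hA hAD) (measurableSet_singleton _),
    hZ.law_count A hA hAD]
  refine poissonLaw_zero_le ?_
  rw [ENNReal.ofReal_mul hlam]
  gcongr

/-- The point of the unit circle with polar angle `θ`. -/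
noncomputable def circlePoint (θ : ℝ) : Plane := !₂[Real.cos θ, Real.sin θ]

theorem norm_circlePoint (θ : ℝ) : ‖circlePoint θ‖ = 1 := by
  rw [← sq_eq_sq₀ (norm_nonneg _) zero_le_one, EuclideanSpace.norm_sq_eq]
  simp [circlePoint, Fin.sum_univ_two]

theorem dist_circlePoint_le (θ φ : ℝ) : dist (circlePoint θ) (circlePoint φ) ≤ 2 * |θ - φ| := by
  have hc := Real.abs_cos_sub_cos_le θ φ
  have hs := Real.abs_sin_sub_sin_le θ φ
  have hc2 := sq_le_sq' (abs_le.1 hc).1 (abs_le.1 hc).2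
  have hs2 := sq_le_sq' (abs_le.1 hs).1 (abs_le.1 hs).2
  rw [dist_eq_norm, ← sq_le_sq₀ (norm_nonneg _) (by positivity), EuclideanSpace.norm_sq_eq]
  simp only [circlePoint, Fin.sum_univ_two, Real.norm_eq_abs, sq_abs, PiLp.sub_apply,
    Matrix.cons_val_zero, Matrix.cons_val_one]
  nlinarith [sq_nonneg |θ - φ|]

theorem exists_eq_circlePoint {ξ : Plane} (hξ : ‖ξ‖ = 1) :
    ∃ θ, |θ| ≤ Real.pi ∧ ξ = circlePoint θ := by
  have h : ξ 0 ^ 2 + ξ 1 ^ 2 = 1 := by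
    have := EuclideanSpace.norm_sq_eq ξ
    rw [hξ, Fin.sum_univ_two, Real.norm_eq_abs, Real.norm_eq_abs, sq_abs, sq_abs] at this
    linarith
  set z : ℂ := ⟨ξ 0, ξ 1⟩ with hz
  have hn : ‖z‖ = 1 := by
    rw [← sq_eq_sq₀ (norm_nonneg _) zero_le_one, Complex.sq_norm, Complex.normSq_apply]
    linarith
  refine ⟨z.arg, Complex.abs_arg_le_pi z, ?_⟩
  ext i
  fin_cases i
  · simpa [circlePoint, hn] using (Complex.norm_mul_cos_arg z).symm
  · simpa [circlePoint, hn] using (Complex.norm_mul_sin_arg z).symm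

/-- The `2 * N + 1` points with polar angles `k / N * π`, `|k| ≤ N`, form a `7 / N`-net. -/
theorem exists_dist_circlePoint_le {ξ : Plane} (hξ : ‖ξ‖ = 1) {N : ℕ} (hN : 0 < N) :
    ∃ k ∈ Finset.Icc (-(N : ℤ)) N, dist ξ (circlePoint (k / N * Real.pi)) ≤ 7 / N := by
  obtain ⟨θ, hθ, rfl⟩ := exists_eq_circlePoint hξ
  have hN' : (0 : ℝ) < N := by exact_mod_cast hN
  have hπ := Real.pi_pos
  obtain ⟨h1, h2⟩ := abs_le.1 hθ
  -- Rounding the angle down to the grid costs less than `π / N`, and `2 * π < 7`.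
  refine ⟨⌊θ / Real.pi * N⌋, ?_, ?_⟩
  · rw [Finset.mem_Icc]
    constructor
    · rw [Int.le_floor]
      push_cast
      have : -1 ≤ θ / Real.pi := by rw [le_div_iff₀ hπ]; linarith
      nlinarith
    · have : (⌊θ / Real.pi * N⌋ : ℝ) ≤ N := by
        refine (Int.floor_le _).trans ?_
        have : θ / Real.pi ≤ 1 := by rw [div_le_iff₀ hπ]; linarith
        nlinarith
      exact_mod_cast this
  · refine (dist_circlePoint_le _ _).trans ?_
    have e : θ - (⌊θ / Real.pi * N⌋ : ℝ) / N * Real.pi =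
        Int.fract (θ / Real.pi * N) * Real.pi / N := by
      rw [Int.fract]
      field_simp
    rw [e, abs_of_nonneg (by have := Int.fract_nonneg (θ / Real.pi * N); positivity),
      ← mul_div_assoc]
    gcongr
    have := Int.fract_lt_one (θ / Real.pi * N)
    have := Int.fract_nonneg (θ / Real.pi * N)
    have := Real.pi_lt_d2
    nlinarith

theorem tendsto_mul_exp_neg_sqrt {a : ℝ} (ha : 0 < a) :
    Tendsto (fun N : ℕ => (2 * N + 1 : ℝ) * Real.exp (-(a * √N))) atTop (𝓝 0) := by
  have h1 : Tendsto (fun N : ℕ => a * √(N : ℝ)) atTop atTop :=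
    (Real.tendsto_sqrt_atTop.comp tendsto_natCast_atTop_atTop).const_mul_atTop ha
  have h2 := (Real.tendsto_pow_mul_exp_neg_atTop_nhds_zero 2).comp h1
  have h0 := (Real.tendsto_pow_mul_exp_neg_atTop_nhds_zero 0).comp h1
  -- `N = (a * √N) ^ 2 / a ^ 2` turns the prefactor into a polynomial in `a * √N`.
  have h := (h2.const_mul (2 / a ^ 2)).add h0
  simp only [mul_zero, add_zero] at h
  refine h.congr fun N => ?_
  simp only [Function.comp_apply, mul_pow, Real.sq_sqrt (Nat.cast_nonneg N)]
  field_simp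

/-- An empty horodisk at any `η` forces an empty shrunken horodisk at a nearby net point, so
uncountably many directions reduce to `2 * N + 1`. Only an outer measure bound is needed, so
measurability of the bad event plays no role. -/
theorem IsHyperbolicPPP.ae_forall_horodisk_nonempty {Ω : Type*} [MeasurableSpace Ω]
    {P : Measure Ω} {lam : ℝ} {Z : Ω → Set Plane} (hZ : IsHyperbolicPPP P lam Z) (hlam : 0 < lam)
    {s : ℝ} (hs0 : 0 < s) (hs : s ≤ 1) :
    ∀ᵐ ω ∂P, ∀ ξ : Plane, ‖ξ‖ = 1 → (Z ω ∩ Metric.ball ((1 - s) • ξ) s).Nonempty := by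
  set a : ℝ := lam * (√s / (9 * √7)) with ha
  have ha0 : 0 < a := by positivity
  have hbound : ∀ N : ℕ, 28 / s ≤ N →
      P {ω | ¬ ∀ ξ : Plane, ‖ξ‖ = 1 → (Z ω ∩ Metric.ball ((1 - s) • ξ) s).Nonempty} ≤
        ENNReal.ofReal ((2 * N + 1 : ℝ) * Real.exp (-(a * √N))) := by
    intro N hNs
    have hN' : (0 : ℝ) < N := lt_of_lt_of_le (by positivity) hNs
    have hN : 0 < N := by exact_mod_cast hN'
    -- The shrinkage equals the mesh of the net; `28 / s ≤ N` makes it at most `s / 4`.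
    have hε : (0 : ℝ) < 7 / N := by positivity
    have hεs : 4 * (7 / N : ℝ) ≤ s := by
      rw [div_le_iff₀ hs0] at hNs
      rw [← mul_div_assoc, div_le_iff₀ hN']
      linarith
    set ξ : ℤ → Plane := fun k => circlePoint (k / N * Real.pi) with hξ
    have hξ1 : ∀ k, ‖ξ k‖ = 1 := fun k => norm_circlePoint _
    have hsub : {ω | ¬ ∀ ξ : Plane, ‖ξ‖ = 1 → (Z ω ∩ Metric.ball ((1 - s) • ξ) s).Nonempty} ⊆
        ⋃ k ∈ Finset.Icc (-(N : ℤ)) N,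
          {ω | Z ω ∩ Metric.ball ((1 - s) • ξ k) (s - 7 / N) = ∅} := by
      intro ω hω
      simp only [Set.mem_ofPred_eq, not_forall, Set.not_nonempty_iff_eq_empty] at hω
      obtain ⟨η, hη, he⟩ := hω
      obtain ⟨k, hk, hd⟩ := exists_dist_circlePoint_le hη hN
      refine Set.mem_biUnion hk ?_
      rw [Set.mem_ofPred_eq, ← Set.subset_empty_iff, ← he]
      refine Set.inter_subset_inter_right _ (Metric.ball_subset_ball' ?_)
      rw [dist_smul₀, Real.norm_of_nonneg (by linarith), dist_comm]
      nlinarith [dist_nonneg (x := η) (y := ξ k)]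
    have hk : ∀ k, P {ω | Z ω ∩ Metric.ball ((1 - s) • ξ k) (s - 7 / N) = ∅} ≤
        ENNReal.ofReal (Real.exp (-(a * √N))) := by
      intro k
      have := hZ.measure_inter_eq_empty_le hlam.le Metric.isOpen_ball.measurableSet
        (ball_subset_Dee (hξ1 k) hs hε.le) (le_areaH_ball (hξ1 k) hs hε hεs)
      refine this.trans_eq ?_
      congr 3
      rw [ha, Real.sqrt_div (by norm_num)]
      have : √(7 : ℝ) ≠ 0 := by positivity
      have : √(N : ℝ) ≠ 0 := by positivity
      field_simp
    calc _ ≤ P (⋃ k ∈ Finset.Icc (-(N : ℤ)) N,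
          {ω | Z ω ∩ Metric.ball ((1 - s) • ξ k) (s - 7 / N) = ∅}) := measure_mono hsub
      _ ≤ ∑ k ∈ Finset.Icc (-(N : ℤ)) N,
          P {ω | Z ω ∩ Metric.ball ((1 - s) • ξ k) (s - 7 / N) = ∅} := measure_biUnion_finset_le _ _
      _ ≤ ∑ k ∈ Finset.Icc (-(N : ℤ)) N, ENNReal.ofReal (Real.exp (-(a * √N))) :=
          Finset.sum_le_sum fun k _ => hk k
      _ = ENNReal.ofReal ((2 * N + 1 : ℝ) * Real.exp (-(a * √N))) := by
          rw [Finset.sum_const, Int.card_Icc, nsmul_eq_mul, ENNReal.ofReal_mul (by positivity)]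
          congr 1
          rw [show ((N : ℤ) + 1 - -(N : ℤ)).toNat = 2 * N + 1 by omega,
            ← ENNReal.ofReal_natCast]
          push_cast
          rfl
  have hlim := ENNReal.tendsto_ofReal (tendsto_mul_exp_neg_sqrt ha0)
  rw [ENNReal.ofReal_zero] at hlim
  refine ae_iff.2 (nonpos_iff_eq_zero.1 (ge_of_tendsto hlim ?_))
  filter_upwards [tendsto_natCast_atTop_atTop.eventually_ge_atTop (28 / s)] with N hN
  exact hbound N hN

end HypVoronoi

theorem lemma2 {Ω : Type*} [MeasurableSpace Ω] (P : MeasureTheory.Measure Ω)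
    [MeasureTheory.IsProbabilityMeasure P] (lam : ℝ) (hlam : 0 < lam)
    (Z : Ω → Set HypVoronoi.Plane) (hZ : HypVoronoi.IsHyperbolicPPP P lam Z) :
    ∀ᵐ ω ∂P, ∀ z₁ ∈ Z ω, ∀ z₂ ∈ Z ω,
      (HypVoronoi.Touch (HypVoronoi.cellR (Z ω) z₁) (HypVoronoi.cellR (Z ω) z₂) ↔
        HypVoronoi.Touch (HypVoronoi.cellH (Z ω) z₁) (HypVoronoi.cellH (Z ω) z₂)) := by
  -- Countably many radii suffice, because a horodisk contains the smaller ones tangent at the same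
  -- point.
  have hae : ∀ᵐ ω ∂P, ∀ n : ℕ, ∀ ξ : HypVoronoi.Plane, ‖ξ‖ = 1 →
      (Z ω ∩ Metric.ball ((1 - 1 / ((n : ℝ) + 1)) • ξ) (1 / ((n : ℝ) + 1))).Nonempty :=
    ae_all_iff.2 fun n => hZ.ae_forall_horodisk_nonempty hlam Nat.one_div_pos_of_nat
      ((div_le_one (by positivity)).2 (by linarith [(Nat.cast_nonneg n : (0 : ℝ) ≤ n)]))
  filter_upwards [hae] with ω hω z₁ h₁ z₂ h₂
  refine ⟨?_, HypVoronoi.Touch.cellR_of_cellH (hZ.subset_disk ω) h₁ h₂⟩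
  rintro ⟨c, hc₁, hc₂⟩
  refine HypVoronoi.Touch.cellH_of_cellR (hZ.subset_disk ω) h₁ h₂ hc₁ hc₂ ?_
  by_contra! hcon
  obtain ⟨s, hs, ξ, hξ, hsub⟩ := HypVoronoi.exists_horodisk_subset (hZ.subset_disk ω h₁) hcon
  obtain ⟨n, hn⟩ := exists_nat_one_div_lt hs
  obtain ⟨z, hz, hzb⟩ := hω n ξ hξ
  have hlt := mem_ball_iff_norm'.1 (hsub _ Nat.one_div_pos_of_nat hn.le hzb)
  exact absurd hlt (not_lt.2 ((HypVoronoi.mem_cellR_iff h₁).1 hc₁ z hz))
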